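/- For $\phi\in L^2(\mathbb{R})$ (complex-valued) let $$V_2(\phi)=\Big\{\sum_{k\in\mathbb{Z}}c(k)\,\phi(\cdot-k)\ :\ c\in\ell^2(\mathbb{Z})\Big\},$$ the series converging in $L^2(\mathbb{R})$. Suppose that $\{\phi(\cdot-k):k\in\mathbb{Z}\}$ is a Riesz basis for $V_2(\phi)$, i.e. for every $c\in\ell^2(\mathbb{Z})$ the series $\sum_{k}c(k)\phi(\cdot-k)$ converges in $L^2(\mathbb{R})$ and there are constants $A,B>0$, independent of $c$, such that $$A\|c\|_{\ell^2}\le\Big\|\sum_{k\in\mathbb{Z}}c(k)\phi(\cdot-k)\Big\|_{L^2}\le B\|c\|_{\ell^2}\qquad\text{for all }c\in\ell^2(\mathbb{Z}).$$ Suppose also that, for some integer $n\ge 2$, $V_2(\phi)$ is $\frac1n\mathbb{Z}$-invariant, i.e. $f(\cdot-\frac mn)\in V_2(\phi)$ for all $f\in V_2(\phi)$ and all $m\in\mathbb{Z}$. Then for every $\epsilon>0$, $$\int_{\mathbb{R}}|\phi(x)|^2\,|x|^{1+\epsilon}\,dx=+\infty.$$ -/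

import Mathlib

open MeasureTheory

noncomputable section

namespace ShiftInvariant

/-- The space `L²(ℝ)` of complex-valued square-integrable functions, modulo a.e. equality. -/
abbrev L2R : Type := Lp ℂ 2 (volume : Measure ℝ)

/-- The space `ℓ²(ℤ)` of complex square-summable sequences. -/
abbrev ell2Z : Type := lp (fun _ : ℤ => ℂ) 2

/-- The translate `f(· - t)` of `f ∈ L²(ℝ)`. -/
def translateL2 (t : ℝ) (f : L2R) : L2R :=
  Lp.compMeasurePreserving (fun x : ℝ => x - t) (measurePreserving_sub_right volume t) f

/-- `V₂(φ)`: all `L²`-sums `∑ c(k) φ(· - k)` with `c ∈ ℓ²(ℤ)`. -/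
def V2 (φ : L2R) : Set L2R :=
  {f | ∃ c : ell2Z, HasSum (fun k : ℤ => c k • translateL2 (k : ℝ) φ) f}

/-- The integer translates of `φ` form a Riesz basis for `V₂(φ)`: for every `c ∈ ℓ²(ℤ)` the
series `∑ c(k) φ(· - k)` converges in `L²`, and its norm is comparable to that of `c`. -/
def IsRieszGenerator (φ : L2R) : Prop :=
  ∃ A B : ℝ, 0 < A ∧ 0 < B ∧ ∀ c : ell2Z, ∃ f : L2R,
    HasSum (fun k : ℤ => c k • translateL2 (k : ℝ) φ) f ∧ A * ‖c‖ ≤ ‖f‖ ∧ ‖f‖ ≤ B * ‖c‖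

/-- `τ(V)`: the set of all `t` such that `f(· - t) ∈ V` for all `f ∈ V`. -/
def invarianceSet (V : Set L2R) : Set ℝ :=
  {t | ∀ f ∈ V, translateL2 t f ∈ V}

/-- `V` is `(1/n)ℤ`-invariant: all elements `m / n` of `(1/n)ℤ` belong to `τ(V)`. -/
def IsInvOneDivInt (n : ℕ) (V : Set L2R) : Prop :=
  ∀ m : ℤ, (m : ℝ) / (n : ℝ) ∈ invarianceSet V

end ShiftInvariant

end

open MeasureTheory Filter Topology

/-! Let `a k = ⟪φ, φ(· - k/n)⟫` and `F(z) = ∑ a k z ^ k`. If the integral were finite, a weighted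
AM-GM bound would make `a` summable (`summable_norm_gram`; the exponent above 1 is what makes the
weights summable), so `F` is continuous on the circle. Expanding `φ(· - 1/n) = ∑ c k φ(· - k)`
gives, formally, `C(z⁻ⁿ) F(z) = z⁻¹ F(z)`. Rotating `z` by an n-th root of unity `w ≠ 1` fixes `C`
but changes `z⁻¹`, hence `F(z) F(zw) = 0`. The rotates of `F` by all n-th roots of unity sum to `n ∑
a (nk) z ^ (nk)`, which the lower Riesz bound keeps away from 0 (`circleSeries_gram_ne_zero`). So
exactly one rotate is nonzero at each point, `{F ≠ 0}` is clopen, and connectedness contradicts `n ≥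
2`. -/

/-! ### Convolution and the shift relation. -/

/-- If `a` is an eigenvector of the correlation with `c` along multiples of `n`, up to a unit
shift, then so is the convolution of `a` with any summable sequence. -/
theorem tsum_mul_conv_shift {a b c : ℤ → ℂ} {n : ℤ} (hn : n ≠ 0) (ha : Summable fun k => ‖a k‖)
    (hb : Summable fun k => ‖b k‖) {C : ℝ} (hc : ∀ k, ‖c k‖ ≤ C) {ν : ℂ}
    (h : ∀ m, HasSum (fun k => c k * a (n * k + m)) (ν * a (m + 1))) (m : ℤ) :
    ∑' k, c k * ∑' l, a l * b (n * k + m - l) = ν * ∑' l, a l * b (m + 1 - l) := by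
  have h1 : ∀ k, ∑' l, a l * b (n * k + m - l) = ∑' l, a (n * k + l) * b (m - l) := fun k => by
    rw [← (Equiv.addLeft (n * k)).tsum_eq]
    refine tsum_congr fun l => ?_
    simp only [Equiv.coe_addLeft]
    congr 2
    ring
  -- Injectivity makes the double family a subfamily of `a ⊗ b`, so a merely bounded `c` suffices
  -- for Fubini.
  have hinj : Function.Injective fun p : ℤ × ℤ => (n * p.1 + p.2, m - p.2) := by
    rintro ⟨k, l⟩ ⟨k', l'⟩ hp
    simp only [Prod.mk.injEq] at hp
    obtain rfl : l = l' := by linarith [hp.2]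
    have : n * k = n * k' := by linarith [hp.1]
    rw [mul_left_cancel₀ hn this]
  have hs : Summable fun p : ℤ × ℤ => c p.1 * (a (n * p.1 + p.2) * b (m - p.2)) := by
    have hab := (ha.mul_of_nonneg hb (fun _ => norm_nonneg _) fun _ => norm_nonneg _)
    refine Summable.of_norm_bounded ((hab.comp_injective hinj).mul_left C) fun p => ?_
    simp only [norm_mul, Function.comp]
    gcongr
    exact hc _
  calc ∑' k, c k * ∑' l, a l * b (n * k + m - l)
      = ∑' k, ∑' l, c k * (a (n * k + l) * b (m - l)) := by
        simp only [h1, tsum_mul_left]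
    _ = ∑' l, ∑' k, c k * (a (n * k + l) * b (m - l)) :=
        (Summable.tsum_comm (f := fun k l => c k * (a (n * k + l) * b (m - l))) hs).symm
    _ = ∑' l, ν * (a (l + 1) * b (m - l)) := by
        refine tsum_congr fun l => ?_
        simp only [← mul_assoc, tsum_mul_right, (h l).tsum_eq]
    _ = ν * ∑' l, a l * b (m + 1 - l) := by
        rw [tsum_mul_left, ← (Equiv.addRight (1 : ℤ)).tsum_eq fun l => a l * b (m + 1 - l)]
        simp

theorem conv_comm (a b : ℤ → ℂ) (m : ℤ) : ∑' l, a l * b (m - l) = ∑' l, b l * a (m - l) := by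
  rw [← (Equiv.subLeft m).tsum_eq]
  simp [mul_comm]

/-- Correlating `c` with the convolution gives the factor 1 through `a` and `ν` through `b`. Working
on sequences avoids the symbol of `c`, which need not converge pointwise. -/
theorem conv_eq_zero_of_shift {a b c : ℤ → ℂ} {n : ℤ} (hn : n ≠ 0) (ha : Summable fun k => ‖a k‖)
    (hb : Summable fun k => ‖b k‖) {C : ℝ} (hc : ∀ k, ‖c k‖ ≤ C) {ν : ℂ} (hν : ν ≠ 1)
    (h1 : ∀ m, HasSum (fun k => c k * a (n * k + m)) (a (m + 1)))
    (h2 : ∀ m, HasSum (fun k => c k * b (n * k + m)) (ν * b (m + 1))) (m : ℤ) :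
    ∑' l, a l * b (m - l) = 0 := by
  have e1 := tsum_mul_conv_shift (ν := 1) hn ha hb hc (by simpa using h1) (m - 1)
  have e2 := tsum_mul_conv_shift hn hb ha hc h2 (m - 1)
  simp only [conv_comm b a] at e2
  rw [e1] at e2
  have : (1 - ν) * ∑' l, a l * b (m - 1 + 1 - l) = 0 := by rw [sub_mul, e2, sub_self]
  simpa [sub_eq_zero, hν.symm] using this

/-! ### Absolutely convergent Fourier series on the circle. -/

/-- The sum of the Fourier series with coefficients `a`. -/
noncomputable def circleSeries (a : ℤ → ℂ) (z : Circle) : ℂ := ∑' k : ℤ, a k * (z : ℂ) ^ k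

theorem summable_circleSeries {a : ℤ → ℂ} (ha : Summable fun k => ‖a k‖) (z : Circle) :
    Summable fun k : ℤ => ‖a k * (z : ℂ) ^ k‖ := by
  simpa [Circle.norm_coe] using ha

theorem continuous_circleSeries {a : ℤ → ℂ} (ha : Summable fun k => ‖a k‖) :
    Continuous (circleSeries a) := by
  refine continuous_tsum (fun k => ?_) ha fun k z => by simp [Circle.norm_coe]
  have : (fun z : Circle => a k * (z : ℂ) ^ k) = fun z : Circle => a k * ((z ^ k : Circle) : ℂ) := by
    ext z; simp
  rw [this]
  exact continuous_const.mul (continuous_subtype_val.comp (continuous_zpow k))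

theorem circleSeries_mul_eq_zero {a b : ℤ → ℂ} (ha : Summable fun k => ‖a k‖)
    (hb : Summable fun k => ‖b k‖) (h : ∀ m, ∑' l, a l * b (m - l) = 0) (z : Circle) :
    circleSeries a z * circleSeries b z = 0 := by
  let e : ℤ × ℤ ≃ ℤ × ℤ :=
    { toFun := fun p => (p.2, p.1 - p.2)
      invFun := fun p => (p.1 + p.2, p.1)
      left_inv := fun p => by simp
      right_inv := fun p => by simp }
  have hz := summable_circleSeries ha z
  have hz' := summable_circleSeries hb z
  have hs := (summable_mul_of_summable_norm hz hz')
  rw [circleSeries, circleSeries, tsum_mul_tsum_of_summable_norm hz hz', ← e.tsum_eq]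
  refine (e.summable_iff.2 hs).tsum_prod.trans ?_
  refine (tsum_congr fun m => ?_).trans tsum_zero
  have : ∀ l, a l * (z : ℂ) ^ l * (b (m - l) * (z : ℂ) ^ (m - l)) =
      (a l * b (m - l)) * (z : ℂ) ^ m := fun l => by
    rw [mul_mul_mul_comm, ← zpow_add₀ z.coe_ne_zero, add_sub_cancel]
  simp only [e, Equiv.coe_fn_mk, Function.comp_apply, this, tsum_mul_right, h, zero_mul]

theorem circleSeries_mul (a : ℤ → ℂ) (z w : Circle) :
    circleSeries a (z * w) = circleSeries (fun k => a k * (w : ℂ) ^ k) z := by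
  refine tsum_congr fun k => ?_
  rw [Circle.coe_mul, mul_zpow]
  ring

/-- Since `w ^ (n * k) = 1`, the twisted sequence `a k * w ^ k` satisfies the same relation with
eigenvalue `w⁻¹ ≠ 1`. -/
theorem circleSeries_mul_rotate_eq_zero {a c : ℤ → ℂ} {n : ℕ} (hn : n ≠ 0)
    (ha : Summable fun k => ‖a k‖) {C : ℝ} (hc : ∀ k, ‖c k‖ ≤ C)
    (h : ∀ m, HasSum (fun k => c k * a (n * k + m)) (a (m + 1)))
    {w : Circle} (hw : w ≠ 1) (hwn : w ^ n = 1) (z : Circle) :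
    circleSeries a z * circleSeries a (z * w) = 0 := by
  have hwn' : (w : ℂ) ^ n = 1 := by rw [← Circle.coe_pow, hwn, Circle.coe_one]
  rw [circleSeries_mul]
  refine circleSeries_mul_eq_zero ha (summable_circleSeries ha w) ?_ z
  refine conv_eq_zero_of_shift (n := n) (ν := (w : ℂ)⁻¹) (by exact_mod_cast hn) ha
    (summable_circleSeries ha w) hc ?_ h fun m => ?_
  · rw [Ne, inv_eq_one]
    exact fun h => hw (Circle.ext h)
  · have e1 : (w : ℂ)⁻¹ * (a (m + 1) * (w : ℂ) ^ (m + 1)) = a (m + 1) * (w : ℂ) ^ m := by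
      rw [zpow_add_one₀ w.coe_ne_zero]
      field_simp [w.coe_ne_zero]
    rw [e1]
    refine ((h m).mul_right ((w : ℂ) ^ m)).congr_fun fun k => ?_
    rw [zpow_add₀ w.coe_ne_zero, zpow_mul, zpow_natCast, hwn', one_zpow]
    ring

theorem sum_circleSeries_rotate {a : ℤ → ℂ} (ha : Summable fun k => ‖a k‖) {n : ℕ} (hn : n ≠ 0)
    {ζ : Circle} (hζ : IsPrimitiveRoot (ζ : ℂ) n) (z : Circle) :
    ∑ j ∈ Finset.range n, circleSeries a (z * ζ ^ j) =
      n * circleSeries (fun k => a (n * k)) (z ^ n) := by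
  have hs : ∀ j ∈ Finset.range n, Summable fun k : ℤ => a k * ((z * ζ ^ j : Circle) : ℂ) ^ k :=
    fun j _ => (summable_circleSeries ha _).of_norm
  have hinj : Function.Injective fun k : ℤ => (n : ℤ) * k :=
    mul_right_injective₀ (by exact_mod_cast hn)
  have hsum : ∀ k : ℤ, ∑ j ∈ Finset.range n, a k * ((z * ζ ^ j : Circle) : ℂ) ^ k =
      a k * (z : ℂ) ^ k * ∑ j ∈ Finset.range n, ((ζ : ℂ) ^ k) ^ j := fun k => by
    rw [Finset.mul_sum]
    refine Finset.sum_congr rfl fun j _ => ?_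
    rw [Circle.coe_mul, Circle.coe_pow, mul_zpow, ← zpow_natCast, ← zpow_natCast, ← zpow_mul,
      ← zpow_mul, mul_comm k, mul_assoc]
  simp only [circleSeries]
  rw [← Summable.tsum_finsetSum hs, ← tsum_mul_left]
  simp only [hsum]
  rw [← hinj.tsum_eq]
  · refine tsum_congr fun k => ?_
    have : (ζ : ℂ) ^ ((n : ℤ) * k) = 1 := by
      rw [zpow_mul, zpow_natCast, hζ.pow_eq_one, one_zpow]
    simp only [this, Circle.coe_pow, zpow_mul, zpow_natCast, one_pow, Finset.sum_const,
      Finset.card_range, nsmul_eq_mul, mul_one]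
    ring
  · intro k hk
    by_contra hk'
    refine hk ?_
    have hne : (ζ : ℂ) ^ k ≠ 1 := fun h1 => hk' <| by
      obtain ⟨l, hl⟩ := (hζ.zpow_eq_one_iff_dvd k).1 h1
      exact ⟨l, hl.symm⟩
    have hg := geom_sum_eq hne n
    have h1 : ((ζ : ℂ) ^ k) ^ n = 1 := by
      rw [← zpow_natCast, zpow_comm, zpow_natCast, hζ.pow_eq_one, one_zpow]
    simp only [hg, h1, sub_self, zero_div, mul_zero]

/-- A summable sequence cannot satisfy a shift relation of step `n ≥ 2` when the decimated series
has no zero on the circle. -/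
theorem false_of_shift_of_decimated_ne_zero {a c : ℤ → ℂ} {n : ℕ} (hn : 2 ≤ n)
    (ha : Summable fun k => ‖a k‖) {C : ℝ} (hc : ∀ k, ‖c k‖ ≤ C)
    (h : ∀ m, HasSum (fun k => c k * a (n * k + m)) (a (m + 1)))
    (hP : ∀ z : Circle, circleSeries (fun k => a (n * k)) z ≠ 0) : False := by
  have hn0 : n ≠ 0 := by lia
  let ζ : Circle := Circle.exp (2 * Real.pi / n)
  have hζ : IsPrimitiveRoot (ζ : ℂ) n := by
    convert Complex.isPrimitiveRoot_exp n hn0 using 1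
    simp only [ζ, Circle.coe_exp]
    push_cast
    congr 1
    ring
  have hζn : ζ ^ n = 1 := Circle.ext (by simpa using hζ.pow_eq_one)
  have hrot : ∀ j ∈ Finset.Ico 1 n, ∀ z : Circle,
      circleSeries a z * circleSeries a (z * ζ ^ j) = 0 := by
    intro j hj z
    rw [Finset.mem_Ico] at hj
    refine circleSeries_mul_rotate_eq_zero hn0 ha hc h (fun h1 => ?_) ?_ z
    · refine hζ.pow_ne_one_of_pos_of_lt (by lia) hj.2 ?_
      rw [← Circle.coe_pow, h1, Circle.coe_one]
    · rw [← pow_mul, mul_comm, pow_mul, hζn, one_pow]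
  have hex : ∀ z : Circle, ∃ j ∈ Finset.range n, circleSeries a (z * ζ ^ j) ≠ 0 := by
    intro z
    by_contra! h0
    have := sum_circleSeries_rotate ha hn0 hζ z
    rw [Finset.sum_eq_zero h0, eq_comm, mul_eq_zero] at this
    rcases this with h1 | h1
    · exact hn0 (by exact_mod_cast h1)
    · exact hP _ h1
  have hcont := continuous_circleSeries ha
  -- Pulled back along `Circle.exp` so that connectedness of `ℝ` applies.
  let S : Set ℝ := {t | circleSeries a (Circle.exp t) ≠ 0}
  have hcj : ∀ j, Continuous fun t : ℝ => circleSeries a (Circle.exp t * ζ ^ j) := fun j =>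
    hcont.comp (Circle.exp.continuous.mul continuous_const)
  have hopen : IsOpen S := isOpen_ne.preimage (hcont.comp Circle.exp.continuous)
  -- Where `F` vanishes some other rotate does not, and conversely; the complement is therefore open
  -- too.
  have hcompl : Sᶜ = ⋃ j ∈ Finset.Ico 1 n, {t : ℝ | circleSeries a (Circle.exp t * ζ ^ j) ≠ 0} := by
    ext t
    simp only [S, Set.mem_compl_iff, Set.mem_ofPred_eq, not_not, Set.mem_iUnion, exists_prop]
    constructor
    · intro h0
      obtain ⟨j, hj, hjt⟩ := hex (Circle.exp t)
      refine ⟨j, Finset.mem_Ico.2 ⟨Nat.one_le_iff_ne_zero.2 ?_, Finset.mem_range.1 hj⟩, hjt⟩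
      rintro rfl
      simp [h0] at hjt
    · rintro ⟨j, hj, hjt⟩
      exact (mul_eq_zero.1 (hrot j hj _)).resolve_right hjt
  have hclopen : IsClopen S := by
    refine ⟨⟨?_⟩, hopen⟩
    rw [hcompl]
    exact isOpen_biUnion fun j _ => isOpen_ne.preimage (hcj j)
  obtain ⟨j, -, hj⟩ := hex 1
  have hne : S.Nonempty := by
    obtain ⟨t, ht⟩ := Circle.exp_surjective (1 * ζ ^ j)
    exact ⟨t, by simpa only [S, Set.mem_ofPred_eq, ht] using hj⟩
  have huniv := hclopen.eq_univ hne
  have hall : ∀ z : Circle, circleSeries a z ≠ 0 := fun z => by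
    obtain ⟨t, rfl⟩ := Circle.exp_surjective z
    exact huniv.ge (Set.mem_univ t)
  exact mul_ne_zero (hall 1) (hall _) (hrot 1 (Finset.mem_Ico.2 ⟨le_rfl, hn⟩) 1)

/-! ### Fejér averages of Toeplitz sums. -/

theorem sum_range_sub_eq {p : ℤ → ℂ} (N : ℕ) :
    ∑ k ∈ Finset.range N, ∑ l ∈ Finset.range N, p (l - k) =
      ∑ M ∈ Finset.range N, ∑ m ∈ Finset.Icc (-(M : ℤ)) M, p m := by
  induction N with
  | zero => simp
  | succ N ih =>
    simp only [Finset.sum_range_succ _ N]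
    rw [← ih, Finset.sum_add_distrib, add_assoc]
    congr 1
    -- The new row and column of the square contribute each difference from `-N` to `N` exactly
    -- once.
    have hsplit : Finset.Icc (-(N : ℤ)) N =
        ((Finset.range N).image fun k : ℕ => (N : ℤ) - k) ∪
          ((Finset.range (N + 1)).image fun k : ℕ => (k : ℤ) - N) := by
      ext m
      simp only [Finset.mem_Icc, Finset.mem_union, Finset.mem_image, Finset.mem_range]
      constructor
      · intro hm
        rcases lt_or_ge 0 m with h0 | h0
        · exact Or.inl ⟨(N - m).toNat, by lia, by lia⟩
        · exact Or.inr ⟨(N + m).toNat, by lia, by lia⟩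
      · rintro (⟨k, hk, rfl⟩ | ⟨k, hk, rfl⟩) <;> constructor <;> lia
    have hdisj : Disjoint ((Finset.range N).image fun k : ℕ => (N : ℤ) - k)
        ((Finset.range (N + 1)).image fun k : ℕ => (k : ℤ) - N) := by
      rw [Finset.disjoint_left]
      simp only [Finset.mem_image, Finset.mem_range]
      rintro _ ⟨k, hk, rfl⟩ ⟨l, hl, h⟩
      lia
    rw [hsplit, Finset.sum_union hdisj, Finset.sum_image fun x _ y _ h => by simpa using h,
      Finset.sum_image fun x _ y _ h => by simpa using h]
    simp only [Finset.sum_range_succ _ N]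

/-- Quadratic averages of a summable Toeplitz kernel converge to its sum. -/
theorem tendsto_average_sum_sub {p : ℤ → ℂ} (hp : Summable p) :
    Tendsto (fun N : ℕ => (N : ℝ)⁻¹ •
      ∑ k ∈ Finset.range N, ∑ l ∈ Finset.range N, p (l - k)) atTop (𝓝 (∑' m, p m)) := by
  simp only [sum_range_sub_eq]
  exact (hp.hasSum.comp
    (Finset.tendsto_Icc_neg_atTop_atTop.comp tendsto_natCast_atTop_atTop)).cesaro_smul

/-! ### The Gram sequence of `φ`. -/

namespace ShiftInvariant

theorem translateL2_translateL2 (s t : ℝ) (f : L2R) :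
    translateL2 s (translateL2 t f) = translateL2 (t + s) f := by
  have h := Lp.compMeasurePreserving_comp_apply f (measurePreserving_sub_right volume t)
    (measurePreserving_sub_right volume s)
  have hfun : (fun x : ℝ => x - t) ∘ (fun x : ℝ => x - s) = fun x => x - (t + s) := by
    ext x
    simp only [Function.comp]
    ring
  simp only [hfun] at h
  exact h.symm

theorem translateL2_zero (f : L2R) : translateL2 0 f = f := by
  have h := Lp.compMeasurePreserving_id_apply f
  have hfun : (id : ℝ → ℝ) = fun x => x - 0 := by ext x; simp
  simp only [hfun] at h
  exact h

theorem inner_translateL2 (s t : ℝ) (f g : L2R) :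
    inner ℂ (translateL2 s f) (translateL2 t g) = inner ℂ f (translateL2 (t - s) g) := by
  have h := (Lp.compMeasurePreservingₗᵢ (E := ℂ) (p := 2) ℂ (fun x : ℝ => x - s)
    (measurePreserving_sub_right volume s)).inner_map_map f (translateL2 (t - s) g)
  rw [← h]
  change _ = inner ℂ (translateL2 s f) (translateL2 s (translateL2 (t - s) g))
  rw [translateL2_translateL2, sub_add_cancel]

/-- The correlations of `φ` with its translates by multiples of `1 / n`. -/
noncomputable def gram (φ : L2R) (n : ℕ) (k : ℤ) : ℂ := inner ℂ φ (translateL2 ((k : ℝ) / n) φ)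

theorem mem_V2_self (φ : L2R) : φ ∈ V2 φ := by
  refine ⟨lp.single 2 0 1, ?_⟩
  convert hasSum_single (f := fun k : ℤ => (lp.single 2 0 1 : ell2Z) k • translateL2 (k : ℝ) φ)
    0 fun k hk => ?_ using 1
  · simp [translateL2_zero]
  · simp [hk]

/-- Pair the expansion of `φ(· - 1/n)` with `φ(· + m/n)`. -/
theorem exists_gram_shift {φ : L2R} {n : ℕ} (hn : n ≠ 0) (hinv : IsInvOneDivInt n (V2 φ)) :
    ∃ c : ell2Z, ∀ m : ℤ, HasSum (fun k => c k * gram φ n (n * k + m)) (gram φ n (m + 1)) := by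
  have hn' : (n : ℝ) ≠ 0 := by exact_mod_cast hn
  obtain ⟨c, hc⟩ := hinv 1 φ (mem_V2_self φ)
  refine ⟨c, fun m => ?_⟩
  have h := hc.mapL (innerSL ℂ (translateL2 (-(m : ℝ) / n) φ))
  simp only [innerSL_apply_apply, inner_smul_right, inner_translateL2] at h
  have e1 : ((1 : ℤ) : ℝ) / n - -(m : ℝ) / n = ((m + 1 : ℤ) : ℝ) / n := by
    push_cast
    ring
  have e2 : ∀ k : ℤ, (k : ℝ) - -(m : ℝ) / n = ((n * k + m : ℤ) : ℝ) / n := fun k => by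
    push_cast
    field_simp
    ring
  simp only [e1, e2] at h
  exact h

theorem norm_sum_translateL2_ge {φ : L2R} {A : ℝ} (hA : 0 ≤ A)
    (h : ∀ c : ell2Z, ∃ f : L2R,
      HasSum (fun k : ℤ => c k • translateL2 (k : ℝ) φ) f ∧ A * ‖c‖ ≤ ‖f‖)
    (x : ℤ → ℂ) (s : Finset ℤ) :
    A ^ 2 * ∑ k ∈ s, ‖x k‖ ^ 2 ≤ ‖∑ k ∈ s, x k • translateL2 (k : ℝ) φ‖ ^ 2 := by
  obtain ⟨f, hf, hle⟩ := h (∑ k ∈ s, lp.single 2 k (x k))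
  have hcoe : ∀ k, (∑ k ∈ s, lp.single 2 k (x k) : ell2Z) k = if k ∈ s then x k else 0 := by
    intro k
    rw [lp.coeFn_sum, Finset.sum_apply]
    simp only [lp.coeFn_single, Finset.sum_pi_single]
  have hf' : f = ∑ k ∈ s, x k • translateL2 (k : ℝ) φ := by
    refine hf.unique ?_
    convert hasSum_sum_of_ne_finset_zero (s := s) fun k hk => ?_ using 1
    · exact Finset.sum_congr rfl fun k hk => by rw [hcoe, if_pos hk]
    · rw [hcoe, if_neg hk, zero_smul]
    · infer_instance
  have hnorm : ‖(∑ k ∈ s, lp.single 2 k (x k) : ell2Z)‖ ^ 2 = ∑ k ∈ s, ‖x k‖ ^ 2 := by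
    simpa using lp.norm_sum_single (E := fun _ : ℤ => ℂ) (p := 2) (by simp) x s
  rw [← hf', ← hnorm, ← mul_pow]
  gcongr

theorem norm_sum_translateL2_sq {φ : L2R} {n : ℕ} (hn : n ≠ 0) (z : Circle) (N : ℕ) :
    ((‖∑ k ∈ Finset.range N, (z : ℂ) ^ (k : ℤ) • translateL2 ((k : ℤ) : ℝ) φ‖ ^ 2 : ℝ) : ℂ) =
      ∑ k ∈ Finset.range N, ∑ l ∈ Finset.range N,
        gram φ n (n * ((l : ℤ) - k)) * (z : ℂ) ^ ((l : ℤ) - k) := by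
  have hn' : (n : ℝ) ≠ 0 := by exact_mod_cast hn
  push_cast
  rw [← RCLike.ofReal_eq_complex_ofReal, ← inner_self_eq_norm_sq_to_K, sum_inner]
  refine Finset.sum_congr rfl fun k _ => ?_
  rw [inner_sum]
  refine Finset.sum_congr rfl fun l _ => ?_
  rw [inner_smul_left, inner_smul_right, inner_translateL2, gram, map_zpow₀,
    ← Circle.coe_inv_eq_conj, Circle.coe_inv, inv_zpow, zpow_sub₀ z.coe_ne_zero]
  have : ((n * ((l : ℤ) - k) : ℤ) : ℝ) / n = (l : ℝ) - k := by
    push_cast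
    field_simp
  rw [this]
  ring

/-- Testing the lower Riesz bound on the unimodular coefficients `z ^ k`, `k < N`, gives at least `A
^ 2 * N`; dividing by `N` yields Fejér means that converge to the series. -/
theorem circleSeries_gram_ne_zero {φ : L2R} (hφ : IsRieszGenerator φ) {n : ℕ} (hn : n ≠ 0)
    (ha : Summable fun k => ‖gram φ n k‖) (z : Circle) :
    circleSeries (fun k => gram φ n (n * k)) z ≠ 0 := by
  obtain ⟨A, B, hA, -, h⟩ := hφ
  have hinj : Function.Injective fun k : ℤ => (n : ℤ) * k :=
    mul_right_injective₀ (by exact_mod_cast hn)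
  have hp := (summable_circleSeries (ha.comp_injective hinj) z).of_norm
  have hlim := (Complex.continuous_re.tendsto _).comp (tendsto_average_sum_sub hp)
  have hle : A ^ 2 ≤ (circleSeries (fun k => gram φ n (n * k)) z).re := by
    refine ge_of_tendsto hlim ?_
    filter_upwards [eventually_gt_atTop 0] with N hN
    have hge := norm_sum_translateL2_ge hA.le
      (fun c => (h c).imp fun f hf => ⟨hf.1, hf.2.1⟩) (fun k => (z : ℂ) ^ k)
      ((Finset.range N).map Nat.castEmbedding)
    simp only [Finset.sum_map, Nat.castEmbedding_apply, norm_zpow, Circle.norm_coe, one_zpow,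
      one_pow, Finset.sum_const, Finset.card_map, Finset.card_range, nsmul_eq_mul, mul_one] at hge
    have hsq := congrArg Complex.re (norm_sum_translateL2_sq (φ := φ) hn z N)
    rw [Complex.ofReal_re] at hsq
    rw [hsq] at hge
    have hN' : (0 : ℝ) < N := by exact_mod_cast hN
    simp only [Function.comp_apply, Complex.smul_re, smul_eq_mul]
    rw [← div_eq_inv_mul, le_div_iff₀ hN']
    exact hge
  intro h0
  rw [h0, Complex.zero_re] at hle
  exact absurd hle (not_le.2 (by positivity))

end ShiftInvariant

/-! ### Weighted estimates and summability of the Gram sequence. -/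

theorem mul_le_sq_mul_add_sq_mul {a b p q : ℝ} (hp : 0 < p) (hq : 0 < q) :
    a * b ≤ a ^ 2 * p * q⁻¹ + b ^ 2 * q * p⁻¹ := by
  have h : a ^ 2 * p * q⁻¹ + b ^ 2 * q * p⁻¹ = ((a * p) ^ 2 + (b * q) ^ 2) / (p * q) := by
    field_simp
  rw [h, le_div_iff₀ (mul_pos hp hq)]
  nlinarith [sq_nonneg (a * p - b * q), sq_nonneg (a * p), sq_nonneg (b * q)]

theorem one_add_rpow_le {x p : ℝ} (hx : 0 ≤ x) (hp : 0 ≤ p) :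
    (1 + x) ^ p ≤ 2 ^ p * (1 + x ^ p) := by
  have hxp := Real.rpow_nonneg hx p
  have h2 : (0 : ℝ) ≤ 2 ^ p := by positivity
  rcases le_total x 1 with h | h
  · calc (1 + x) ^ p ≤ 2 ^ p := Real.rpow_le_rpow (by linarith) (by linarith) hp
      _ ≤ 2 ^ p * (1 + x ^ p) := le_mul_of_one_le_right h2 (by linarith)
  · calc (1 + x) ^ p ≤ (2 * x) ^ p := Real.rpow_le_rpow (by linarith) (by linarith) hp
      _ = 2 ^ p * x ^ p := Real.mul_rpow zero_le_two hx
      _ ≤ 2 ^ p * (1 + x ^ p) := by gcongr; linarith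

theorem summable_int_one_add_abs_rpow {p : ℝ} (hp : 1 < p) :
    Summable fun l : ℤ => (1 + |(l : ℝ)|) ^ (-p) := by
  have h : Summable fun k : ℕ => (1 + (k : ℝ)) ^ (-p) := by
    have := (summable_nat_add_iff 1).2 (Real.summable_nat_rpow.2 (neg_lt_neg hp))
    simpa [add_comm] using this
  refine Summable.of_nat_of_neg ?_ ?_ <;> simpa using h

/-- Sums of a polynomially decaying weight over translates of `(1/n)ℤ` are uniformly bounded. -/
theorem exists_tsum_weight_le {p : ℝ} (hp : 1 < p) {n : ℕ} (hn : 2 ≤ n) :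
    ∃ S : ENNReal, S ≠ ⊤ ∧
      ∀ x : ℝ, ∑' k : ℤ, ENNReal.ofReal ((1 + |x - (k : ℝ) / n|) ^ (-p)) ≤ S := by
  have hn0 : (2 : ℝ) ≤ n := by exact_mod_cast hn
  have hn' : (0 : ℝ) < n := by linarith
  have hs : Summable fun l : ℤ => ((1 + |(l : ℝ)|) / n) ^ (-p) := by
    refine ((summable_int_one_add_abs_rpow hp).div_const ((n : ℝ) ^ (-p))).congr fun l => ?_
    rw [Real.div_rpow (by positivity) hn'.le]
  refine ⟨∑' l : ℤ, ENNReal.ofReal (((1 + |(l : ℝ)|) / n) ^ (-p)), hs.tsum_ofReal_ne_top,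
    fun x => ?_⟩
  -- Reindexing by `⌊n * x⌋ - l` leaves only the fractional part of `n * x`, so the bound is uniform
  -- in `x`.
  rw [← (Equiv.subLeft ⌊n * x⌋).tsum_eq]
  refine ENNReal.tsum_le_tsum fun l => ENNReal.ofReal_le_ofReal ?_
  refine Real.rpow_le_rpow_of_nonpos (by positivity) ?_ (by linarith)
  have hx : x - ((Equiv.subLeft ⌊n * x⌋ l : ℤ) : ℝ) / n = (Int.fract (n * x) + l) / n := by
    rw [Equiv.subLeft_apply, Int.cast_sub, Int.fract]
    field_simp
    ring
  rw [hx, abs_div, abs_of_pos hn', div_le_iff₀ hn', add_mul, div_mul_cancel₀ _ hn'.ne']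
  have h1 := Int.fract_nonneg (n * x)
  have h2 := Int.fract_lt_one (n * x)
  have h3 : |(l : ℝ)| ≤ |Int.fract (n * x) + l| + 1 := by
    have := abs_sub (Int.fract (n * x) + (l : ℝ)) (Int.fract (n * x))
    rw [add_sub_cancel_left, abs_of_nonneg h1] at this
    linarith
  -- The fractional part costs 1, so `1 + |l| ≤ n + |fract + l|` needs `2 ≤ n`.
  linarith

namespace ShiftInvariant

theorem enorm_gram_le (φ : L2R) (n : ℕ) (k : ℤ) :
    ‖gram φ n k‖ₑ ≤ ∫⁻ x, ENNReal.ofReal (‖φ x‖ * ‖φ (x - (k : ℝ) / n)‖) := by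
  rw [gram, L2.inner_def]
  refine (enorm_integral_le_lintegral_enorm _).trans (lintegral_mono_ae ?_)
  filter_upwards [Lp.coeFn_compMeasurePreserving φ
    (measurePreserving_sub_right volume ((k : ℝ) / n))] with x hx
  rw [← ofReal_norm, translateL2, hx]
  exact ENNReal.ofReal_le_ofReal (norm_inner_le_norm _ _)

theorem lintegral_weight_ne_top (φ : L2R) {p : ℝ} (hp : 0 ≤ p)
    (h : ∫⁻ x : ℝ, ENNReal.ofReal (‖φ x‖ ^ 2 * |x| ^ p) ≠ ⊤) :
    ∫⁻ x : ℝ, ENNReal.ofReal (‖φ x‖ ^ 2 * (1 + |x|) ^ p) ≠ ⊤ := by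
  have hsq : ∫⁻ x : ℝ, ENNReal.ofReal (‖φ x‖ ^ 2) ≠ ⊤ :=
    ((memLp_two_iff_integrable_sq_norm (Lp.aestronglyMeasurable φ)).1 (Lp.memLp φ)).lintegral_lt_top.ne
  have hmeas : Measurable fun x : ℝ => ENNReal.ofReal (‖φ x‖ ^ 2) :=
    ((Lp.stronglyMeasurable φ).measurable.norm.pow_const 2).ennreal_ofReal
  refine ne_top_of_le_ne_top
    (ENNReal.mul_ne_top (ENNReal.ofReal_ne_top (r := 2 ^ p)) (ENNReal.add_ne_top.2 ⟨hsq, h⟩)) ?_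
  rw [← lintegral_add_left hmeas, ← lintegral_const_mul' _ _ ENNReal.ofReal_ne_top]
  refine lintegral_mono fun x => ?_
  have hxp := Real.rpow_nonneg (abs_nonneg x) p
  rw [← ENNReal.ofReal_add (by positivity) (by positivity), ← ENNReal.ofReal_mul (by positivity)]
  refine ENNReal.ofReal_le_ofReal ?_
  calc ‖φ x‖ ^ 2 * (1 + |x|) ^ p ≤ ‖φ x‖ ^ 2 * (2 ^ p * (1 + |x| ^ p)) := by
        gcongr
        exact one_add_rpow_le (abs_nonneg x) hp
    _ = 2 ^ p * (‖φ x‖ ^ 2 + ‖φ x‖ ^ 2 * |x| ^ p) := by ring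

/-- AM-GM with the weights `(1 + |x|) ^ p` and `(1 + |x - t|) ^ p`, then a translation by `t` in the
second term, puts all dependence on `t` in a decaying factor that can be summed over `t = k / n`. -/
theorem lintegral_mul_translate_le (φ : L2R) {p : ℝ} (t : ℝ) :
    ∫⁻ x, ENNReal.ofReal (‖φ x‖ * ‖φ (x - t)‖) ≤
      (∫⁻ x, ENNReal.ofReal (‖φ x‖ ^ 2 * (1 + |x|) ^ p) *
        ENNReal.ofReal ((1 + |x - t|) ^ (-p))) +
      ∫⁻ x, ENNReal.ofReal (‖φ x‖ ^ 2 * (1 + |x|) ^ p) *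
        ENNReal.ofReal ((1 + |x + t|) ^ (-p)) := by
  have hφ := (Lp.stronglyMeasurable φ).measurable
  rw [← lintegral_sub_right_eq_self (fun x => ENNReal.ofReal (‖φ x‖ ^ 2 * (1 + |x|) ^ p) *
        ENNReal.ofReal ((1 + |x + t|) ^ (-p))) t, ← lintegral_add_left (by fun_prop)]
  refine lintegral_mono fun x => ?_
  have h1 : 0 < (1 + |x|) ^ p := by positivity
  have h2 : 0 < (1 + |x - t|) ^ p := by positivity
  rw [sub_add_cancel, ← ENNReal.ofReal_mul (by positivity), ← ENNReal.ofReal_mul (by positivity),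
    ← ENNReal.ofReal_add (by positivity) (by positivity), Real.rpow_neg (by positivity),
    Real.rpow_neg (by positivity)]
  exact ENNReal.ofReal_le_ofReal (mul_le_sq_mul_add_sq_mul h1 h2)

theorem summable_norm_gram (φ : L2R) {p : ℝ} (hp : 1 < p) {n : ℕ} (hn : 2 ≤ n)
    (h : ∫⁻ x : ℝ, ENNReal.ofReal (‖φ x‖ ^ 2 * |x| ^ p) ≠ ⊤) :
    Summable fun k => ‖gram φ n k‖ := by
  have hφ := (Lp.stronglyMeasurable φ).measurable
  obtain ⟨S, hS, hle⟩ := exists_tsum_weight_le hp hn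
  have hle' : ∀ x : ℝ, ∑' k : ℤ, ENNReal.ofReal ((1 + |x + (k : ℝ) / n|) ^ (-p)) ≤ S := fun x => by
    rw [← (Equiv.neg ℤ).tsum_eq]
    simpa [neg_div, ← sub_eq_add_neg] using hle x
  have hg := lintegral_weight_ne_top φ (by linarith) h
  have hbound : ∀ u : ℤ → ℝ → ENNReal, (∀ k, Measurable (u k)) → (∀ x, ∑' k, u k x ≤ S) →
      ∑' k, ∫⁻ x, ENNReal.ofReal (‖φ x‖ ^ 2 * (1 + |x|) ^ p) * u k x ≠ ⊤ := by
    intro u hu huS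
    rw [← lintegral_tsum fun k => by fun_prop]
    refine ne_top_of_le_ne_top (ENNReal.mul_ne_top hg hS) ?_
    rw [← lintegral_mul_const' _ _ hS]
    refine lintegral_mono fun x => ?_
    rw [ENNReal.tsum_mul_left]
    gcongr
    exact huS x
  have hsum : ∑' k, ‖gram φ n k‖ₑ ≠ ⊤ := by
    refine ne_top_of_le_ne_top (ENNReal.add_ne_top.2
      ⟨hbound (fun k x => ENNReal.ofReal ((1 + |x - (k : ℝ) / n|) ^ (-p)))
        (fun k => by fun_prop) hle,
      hbound (fun k x => ENNReal.ofReal ((1 + |x + (k : ℝ) / n|) ^ (-p)))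
        (fun k => by fun_prop) hle'⟩) ?_
    rw [← ENNReal.tsum_add]
    exact ENNReal.tsum_le_tsum fun k =>
      (enorm_gram_le φ n k).trans (lintegral_mul_translate_le φ _)
  simpa only [toReal_enorm] using ENNReal.summable_toReal hsum

end ShiftInvariant

theorem mainTheorem2 (φ : ShiftInvariant.L2R) (hφ : ShiftInvariant.IsRieszGenerator φ)
    (n : ℕ) (hn : 2 ≤ n) (hinv : ShiftInvariant.IsInvOneDivInt n (ShiftInvariant.V2 φ))
    (ε : ℝ) (hε : 0 < ε) :
    ∫⁻ x : ℝ, ENNReal.ofReal (‖φ x‖ ^ 2 * |x| ^ (1 + ε)) = ⊤ := by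
  by_contra h
  have hn0 : n ≠ 0 := by lia
  have ha := ShiftInvariant.summable_norm_gram φ (by linarith) hn h
  obtain ⟨c, hc⟩ := ShiftInvariant.exists_gram_shift hn0 hinv
  exact false_of_shift_of_decimated_ne_zero hn ha (lp.norm_apply_le_norm two_ne_zero c) hc
    (ShiftInvariant.circleSeries_gram_ne_zero hφ hn0 ha)
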